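/- Let $\mathbb{T}\subseteq\mathbb{R}$ be an isolated time scale (a nonempty closed set all of whose points are isolated in it), with forward jump $\sigma(t)=\inf\{s\in\mathbb{T}:s>t\}$ (and $\sigma(\max\mathbb{T})=\max\mathbb{T}$) and graininess $\mu(t)=\sigma(t)-t$; write $f^\sigma=f\circ\sigma$ and $\alpha^\dagger=1/\alpha$ for $\alpha\ne0$, $0^\dagger=0$. For a time scale $S$, $S^\kappa$ is $S$ without its maximum if the maximum exists and is left-scattered (i.e. is not also the minimum, in the isolated case), and $S^\kappa=S$ otherwise; $S^{\kappa^2}=(S^\kappa)^\kappa$. Delta derivatives $f^\Delta$, delta integrals $\int f\,\Delta t$ (Cauchy integrals through antiderivatives), rd-continuity, $C^1_{rd}$, and the exponential $e_p(t,s)=\exp\int_s^t\xi_{\mu(\tau)}(p(\tau))\Delta\tau$ with $\xi_h(z)=\mathrm{Log}(1+hz)/h$, $\xi_0(z)=z$, are the usual ones. Let $a<b$ be points of $\mathbb{T}$, $[a,b]_{\mathbb{T}}=[a,b]\cap\mathbb{T}$, and suppose that $\mathbb{T}\cap[a,\infty)$ has at least three points. Let $L:[a,b]_{\mathbb{T}}\times\mathbb{R}^2\to\mathbb{R}$,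 $(t,x,v)\mapsto L(t,x,v)$, be $C^2$ in $(x,v)$ uniformly in $t$, with $L,L_x,L_v,L_{vv}$ rd-continuous in $t$ along $(t,y^\sigma(t),y^\Delta(t))$ for every admissible $y$, i.e. $y\in C^1_{rd}(\mathbb{T})$ with $y(a)=y(b)=0$. Put $$P(t,x)=L(t,x,0),\qquad Q(t,x)=L_v(t,x,0),\qquad R(t,x,0)=L_{vv}(t,x,0).$$ Suppose that $\hat y\equiv0$ is a local minimizer of $$\mathcal{L}(y)=\int_a^bL\bigl(t,y^\sigma(t),y^\Delta(t)\bigr)\,\Delta t,\qquad y(a)=y(b)=0,$$ among admissible $y$, with respect to the norm $\sup_{[a,b]^\kappa_{\mathbb{T}}}|y^\sigma|+\sup_{[a,b]^\kappa_{\mathbb{T}}}|y^\Delta|$, and that the strengthened Legendre condition holds at $\hat y\equiv 0$: $$R(t,0,0)+\mu(t)\bigl\{2Q_x(t,0)+\mu(t)P_{xx}(t,0)+(\mu^\sigma(t))^\dagger R(\sigma(t),0,0)\bigr\}>0,\qquad t\in[a,b]^{\kappa^2}_{\mathbb{T}} .$$ Then there are $C,R_0\in\mathbb{R}$ and functions $p:[a,b]_{\mathbb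 T}\to\mathbb R$, $q:[a,b]_{\mathbb T}\times\mathbb R\to\mathbb R$, $w:[a,b]_{\mathbb T}\times\mathbb R^2\to\mathbb R$ with the following properties. (1) $P(t,\cdot)$ is $C^2$ uniformly in $t$; $P,P_x$ are rd-continuous in $t$ for all admissible $y$; $P_{xx}(\cdot,0)$ is rd-continuous; $p\in C^1_{rd}$ and $p(t)>0$ for $t\in[a,b]^{\kappa^2}_{\mathbb{T}}$; $q(t,\cdot)$ is $C^1$ uniformly in $t$, and $C^2$ uniformly in $t$ if $L_v(t,\cdot,0)$ is; $q,q_x$ are rd-continuous in $t$ for all admissible $y$; $w(t,\cdot,\cdot)$ is continuous uniformly in $t$ and $w$ is rd-continuous in $t$ for all admissible $y$; if $L_{vv}(t,\cdot,\cdot)$ is $C^2$ uniformly in $t$, then so is $w(t,\cdot,\cdot)$, and $w_x,w_v,w_{vv}$ are rd-continuous in $t$ for all admissible $y$. (2) For $t\in[a,b]^{\kappa^2}_{\mathbb{T}}$ the left-hand side of the Legendre condition equals $p(t)$. With $$r(t)=-\frac{1+\mu(t)(\mu^\sigma(t))^\dagger}{\mu^2(t)(\mu^\sigma(t))^\dagger},\qquad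 s(t)=\frac{p(t)-\mu(t)[2Q_x(t,0)+\mu(t)P_{xx}(t,0)]}{\mu^2(t)(\mu^\sigma(t))^\dagger},$$ $r$ is rd-continuous and regressive ($1+\mu(t) r(t)\neq0$) on $[a,b]^{\kappa^2}_{\mathbb{T}}$, and there $$R^\Delta(t,0,0)=r(t)R(t,0,0)+s(t),\qquad R(a,0,0)=R_0 .$$ (3) For $t\in[a,b]^\kappa_{\mathbb{T}}$, $$R(t,0,0)=e_r(t,a)R_0+\int_a^te_r(t,\sigma(\tau))s(\tau)\,\Delta\tau .$$ (4) For $t\in[a,b]^\kappa_{\mathbb{T}}$ and all $x,v\in\mathbb{R}$ (in particular for $x=y^\sigma(t)$, $v=y^\Delta(t)$ with $y$ admissible), $$L(t,x,v)=P(t,x)+\Bigl(C+\int_a^tP_x(\tau,0)\Delta\tau+q(t,x)-q(t,0)\Bigr)v+\Bigl(e_r(t,a)R_0+\int_a^te_r(t,\sigma(\tau))s(\tau)\Delta\tau+w(t,x,v)-w(t,0,0)\Bigr)\frac{v^2}{2}.$$ -/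

import Mathlib

open Filter Topology

noncomputable section

namespace TimeScale

/-! ## Delta calculus on a time scale `T ⊆ ℝ` -/

/-- A time scale is a nonempty closed subset of the real line. -/
def IsTimeScale (T : Set ℝ) : Prop := IsClosed T ∧ T.Nonempty

/-- Every point of `T` has a neighbourhood that contains no other point of `T`. -/
def IsIsolated (T : Set ℝ) : Prop :=
  ∀ t ∈ T, ∃ δ > 0, Set.Ioo (t - δ) (t + δ) ∩ T = {t}

open Classical in
/-- The forward jump operator `σ`. -/
def sigma (T : Set ℝ) (t : ℝ) : ℝ := if IsGreatest T t then t else sInf {s ∈ T | t < s}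

open Classical in
/-- The backward jump operator `ρ`. -/
def rho (T : Set ℝ) (t : ℝ) : ℝ := if IsLeast T t then t else sSup {s ∈ T | s < t}

/-- The graininess function `μ(t) = σ(t) - t`. -/
def mu (T : Set ℝ) (t : ℝ) : ℝ := sigma T t - t

/-- `T^κ`: the time scale without its maximum, if it has one that is left-scattered. -/
def kappa (T : Set ℝ) : Set ℝ := {t ∈ T | ¬ (IsGreatest T t ∧ rho T t < t)}

/-- The time scale interval `[a,b]_T`. -/
def interval (T : Set ℝ) (a b : ℝ) : Set ℝ := Set.Icc a b ∩ T

section Calculus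

variable {E : Type*} [NormedAddCommGroup E] [NormedSpace ℝ E]

/-- `f` is delta differentiable at `t`, with delta derivative `f'`. -/
def HasDeltaDerivAt (T : Set ℝ) (f : ℝ → E) (f' : E) (t : ℝ) : Prop :=
  ∀ ε > 0, ∀ᶠ s in 𝓝[T] t,
    ‖f (sigma T t) - f s - (sigma T t - s) • f'‖ ≤ ε * |sigma T t - s|

open Classical in
/-- The delta derivative `f^Δ(t)` (used at points of `T^κ`, where it is unique). -/
def deltaDeriv (T : Set ℝ) (f : ℝ → E) (t : ℝ) : E :=
  if h : ∃ f', HasDeltaDerivAt T f f' t then h.choose else 0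

/-- `F` is an antiderivative of `f` on `T`. -/
def IsAntiderivative (T : Set ℝ) (F f : ℝ → E) : Prop :=
  ∀ t ∈ kappa T, HasDeltaDerivAt T F (f t) t

open Classical in
/-- The Cauchy delta integral `∫_a^b f(t) Δt = F(b) - F(a)`, `F` an antiderivative of `f`. -/
def deltaIntegral (T : Set ℝ) (f : ℝ → E) (a b : ℝ) : E :=
  if h : ∃ F, IsAntiderivative T F f then h.choose b - h.choose a else 0

/-- `f` is rd-continuous on the time scale `T`: continuous at right-dense points, with finite
left-sided limits at left-dense points. -/
def RdContinuous (T : Set ℝ) (f : ℝ → E) : Prop :=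
  (∀ t ∈ T, sigma T t = t → ContinuousWithinAt f T t) ∧
  (∀ t ∈ T, rho T t = t → ∃ l, Tendsto f (𝓝[T ∩ Set.Iio t] t) (𝓝 l))

/-- `f` belongs to `C¹_rd(T)`. -/
def C1rd (T : Set ℝ) (f : ℝ → E) : Prop :=
  (∀ t ∈ kappa T, ∃ f', HasDeltaDerivAt T f f' t) ∧ RdContinuous (kappa T) (deltaDeriv T f)

end Calculus

/-- The cylinder transformation `ξ_h(z) = Log(1 + h z) / h`, and `ξ_0(z) = z`. -/
def cylinder (h : ℝ) (z : ℂ) : ℂ := if h = 0 then z else Complex.log (1 + h * z) / h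

/-- The exponential function `e_p(t,s) = exp (∫_s^t ξ_{μ(τ)}(p(τ)) Δτ)` of the time scale `T`.
The principal logarithm of a negative `1 + μ p` is not real, so the integral is complex; for a
real regressive `p` its exponential is a real number, which is what `re` extracts. -/
def timeExp (T : Set ℝ) (p : ℝ → ℝ) (t s : ℝ) : ℝ :=
  (Complex.exp (deltaIntegral T (fun τ => cylinder (mu T τ) (p τ : ℂ)) s t)).re

/-! ## The variational problem -/

/-- `y ∈ C¹_rd(T)` is admissible if `y(a) = α` and `y(b) = β`. -/
def Admissible (T : Set ℝ) (a b α β : ℝ) (y : ℝ → ℝ) : Prop :=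
  C1rd T y ∧ y a = α ∧ y b = β

/-- The functional `𝓛(y) = ∫_a^b L(t, y^σ(t), y^Δ(t)) Δt`. -/
def functional (T : Set ℝ) (a b : ℝ) (L : ℝ → ℝ → ℝ → ℝ) (y : ℝ → ℝ) : ℝ :=
  deltaIntegral T (fun t => L t (y (sigma T t)) (deltaDeriv T y t)) a b

/-- The norm `sup |f^σ| + sup |f^Δ|`, both suprema over `[a,b]_T^κ`. -/
def c1Norm (T : Set ℝ) (a b : ℝ) (f : ℝ → ℝ) : ℝ :=
  sSup ((fun t => |f (sigma T t)|) '' kappa (interval T a b)) +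
    sSup ((fun t => |deltaDeriv T f t|) '' kappa (interval T a b))

/-- `y₀` is a local minimizer of the functional under `y(a) = α`, `y(b) = β`. -/
def IsLocalMinimizer (T : Set ℝ) (a b α β : ℝ) (L : ℝ → ℝ → ℝ → ℝ) (y₀ : ℝ → ℝ) : Prop :=
  Admissible T a b α β y₀ ∧ ∃ δ > 0, ∀ y, Admissible T a b α β y →
    c1Norm T a b (fun t => y t - y₀ t) < δ → functional T a b L y₀ ≤ functional T a b L y

/-! Partial derivatives of a Lagrangian `L(t,x,v)`. -/

def Lx (L : ℝ → ℝ → ℝ → ℝ) (t x v : ℝ) : ℝ := deriv (fun x' => L t x' v) x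
def Lv (L : ℝ → ℝ → ℝ → ℝ) (t x v : ℝ) : ℝ := deriv (fun v' => L t x v') v
def Lxx (L : ℝ → ℝ → ℝ → ℝ) (t x v : ℝ) : ℝ := deriv (fun x' => Lx L t x' v) x
def Lxv (L : ℝ → ℝ → ℝ → ℝ) (t x v : ℝ) : ℝ := deriv (fun x' => Lv L t x' v) x
def Lvv (L : ℝ → ℝ → ℝ → ℝ) (t x v : ℝ) : ℝ := deriv (fun v' => Lv L t x v') v

/-- The strengthened Legendre condition along `y` on `[a,b]_T^{κ²}`. In Lean `0⁻¹ = 0`, so that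
`⁻¹` is the operation `†`. -/
def StrengthenedLegendre (T : Set ℝ) (a b : ℝ) (L : ℝ → ℝ → ℝ → ℝ) (y : ℝ → ℝ) : Prop :=
  ∀ t ∈ kappa (kappa (interval T a b)),
    let A := fun u => Lvv L u (y (sigma T u)) (deltaDeriv T y u)
    let B := fun u => Lxx L u (y (sigma T u)) (deltaDeriv T y u)
    let C := fun u => Lxv L u (y (sigma T u)) (deltaDeriv T y u)
    0 < A t + mu T t * (C t + C t + mu T t * B t + (mu T (sigma T t))⁻¹ * A (sigma T t))

/-- `f(t, ·)` is of class `C^k` uniformly in `t ∈ S`: it is `C^k` for every `t ∈ S`, and each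
derivative of order at most `k` is continuous at every point, uniformly in `t ∈ S`. -/
def UniformlyContDiff {V : Type*} [NormedAddCommGroup V] [NormedSpace ℝ V]
    (k : ℕ) (S : Set ℝ) (f : ℝ → V → ℝ) : Prop :=
  (∀ t ∈ S, ContDiff ℝ k (f t)) ∧
  ∀ j ≤ k, Equicontinuous (fun (t : S) => iteratedFDeriv ℝ j (f t))

/-- `f(t, y^σ(t), y^Δ(t))` is rd-continuous in `t`, for all admissible `y` with null boundary
conditions. -/
def RdAlongPaths (T : Set ℝ) (a b : ℝ) (f : ℝ → ℝ → ℝ → ℝ) : Prop :=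
  ∀ y, Admissible T a b 0 0 y →
    RdContinuous (kappa (interval T a b)) (fun t => f t (y (sigma T t)) (deltaDeriv T y t))

/-- The standing assumptions on the Lagrangian. -/
structure RegularLagrangian (T : Set ℝ) (a b : ℝ) (L : ℝ → ℝ → ℝ → ℝ) : Prop where
  contDiff : UniformlyContDiff 2 (interval T a b) (fun t (z : ℝ × ℝ) => L t z.1 z.2)
  rd : RdAlongPaths T a b L
  rd_x : RdAlongPaths T a b (Lx L)
  rd_v : RdAlongPaths T a b (Lv L)
  rd_vv : RdAlongPaths T a b (Lvv L)

/-- `P(t,x) = L(t,x,0)`. -/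
def coeffP (L : ℝ → ℝ → ℝ → ℝ) (t x : ℝ) : ℝ := L t x 0

/-- `Q(t,x) = L_v(t,x,0)`. -/
def coeffQ (L : ℝ → ℝ → ℝ → ℝ) (t x : ℝ) : ℝ := Lv L t x 0

/-- `R(t,x,0) = L_vv(t,x,0)`. -/
def coeffR (L : ℝ → ℝ → ℝ → ℝ) (t x : ℝ) : ℝ := Lvv L t x 0

/-- `P_x(t,0)`. -/
def Px0 (L : ℝ → ℝ → ℝ → ℝ) (t : ℝ) : ℝ := deriv (coeffP L t) 0

/-- `P_xx(t,0)`. -/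
def Pxx0 (L : ℝ → ℝ → ℝ → ℝ) (t : ℝ) : ℝ := deriv (deriv (coeffP L t)) 0

/-- `Q_x(t,0)`. -/
def Qx0 (L : ℝ → ℝ → ℝ → ℝ) (t : ℝ) : ℝ := deriv (coeffQ L t) 0

/-- `r = -(1 + μ (μ^σ)†) / (μ² (μ^σ)†)`. -/
def rFun (T : Set ℝ) (t : ℝ) : ℝ :=
  -((1 + mu T t * (mu T (sigma T t))⁻¹) / (mu T t ^ 2 * (mu T (sigma T t))⁻¹))

/-- `s = (p - μ [2 Q_x(t,0) + μ P_xx(t,0)]) / (μ² (μ^σ)†)`. -/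
def sFun (T : Set ℝ) (L : ℝ → ℝ → ℝ → ℝ) (p : ℝ → ℝ) (t : ℝ) : ℝ :=
  (p t - mu T t * (2 * Qx0 L t + mu T t * Pxx0 L t)) / (mu T t ^ 2 * (mu T (sigma T t))⁻¹)

end TimeScale

end

/-! On an isolated time scale `[a,b]_T` is finite, so uniformity in `t` and rd-continuity cost
nothing, delta derivatives at points with `μ ≠ 0` are difference quotients, and `∫` is governed by
its one-step rule (`deltaIntegral_sigma`). Three facts remain. Taylor's formula in `v` with integral
remainder (`eq_add_remainderCoeff`) gives `L = P + Q v + w v²/2`, where `w(t,x,v)` averages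
`L_vv(t,x,sv)` with weight `2(1-s)`. Thus `w(t,0,0) = R(t,0,0)`, and `w` is as smooth as `L_vv`.
Take `q = Q`. Local minimality enters only through the integrated Euler-Lagrange equation `Q(t,0) =
C + ∫ P_x(τ,0) Δτ` (`eulerLagrange`). Let `p` be the Legendre expression. Solving its definition for
`R(σ(t),0,0)` yields the linear equation `R^Δ = rR + s`, and variation of constants
(`eq_timeExp_mul_add`) expresses `R(t,0,0)` through `e_r`. Substituting both formulas turns the
claimed form of `L` into Taylor's. -/

/-! ### Parameter integrals and Taylor's formula -/

theorem contDiff_intervalIntegral_param {E : Type} [NormedAddCommGroup E] [NormedSpace ℝ E]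
    [ProperSpace E] (n : ℕ) : ∀ {G : Type} [NormedAddCommGroup G] [NormedSpace ℝ G]
    [CompleteSpace G] {F : E × ℝ → G}, ContDiff ℝ n F →
    ContDiff ℝ n (fun z => ∫ s in (0 : ℝ)..1, F (z, s)) := by
  induction n with
  | zero =>
    intro G _ _ _ F hF
    exact contDiff_zero.2 (intervalIntegral.continuous_parametric_intervalIntegral_of_continuous'
      (f := fun z s => F (z, s)) (by simpa [Function.uncurry_def] using hF.continuous) 0 1)
  | succ n ih =>
    intro G _ _ _ F hF
    push_cast at hF ⊢
    set F' : E × ℝ → E →L[ℝ] G :=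
      fun z => (fderiv ℝ F z).comp (ContinuousLinearMap.inl ℝ E ℝ) with hF'
    have hF'c : ContDiff ℝ n F' := by
      have h1 : ContDiff ℝ n (fderiv ℝ F) := hF.fderiv_right le_rfl
      exact h1.clm_comp contDiff_const
    have hd : ∀ z s, HasFDerivAt (fun z' => F (z', s)) (F' (z, s)) z := fun z s =>
      ((hF.differentiable (by simp)).differentiableAt.hasFDerivAt (x := (z, s))).comp z
        (hasFDerivAt_prodMk_left z s)
    refine contDiff_succ_iff_hasFDerivAt.2 ⟨fun z => ∫ s in (0 : ℝ)..1, F' (z, s), ih hF'c, ?_⟩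
    intro z₀
    -- Compactness of the ball times `[0,1]` supplies the constant dominating the derivative near
    -- `z₀`.
    obtain ⟨K, hK⟩ := ((isCompact_closedBall z₀ 1).prod
      (isCompact_Icc (a := (0 : ℝ)) (b := 1))).exists_bound_of_continuousOn
      hF'c.continuous.continuousOn
    refine (intervalIntegral.hasFDerivAt_integral_of_dominated_of_fderiv_le
      (F := fun z s => F (z, s)) (F' := fun z s => F' (z, s)) (bound := fun _ => K)
      (Metric.ball_mem_nhds z₀ one_pos) ?_ ?_ ?_ ?_ ?_ ?_)
    · exact Eventually.of_forall fun z =>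
        (hF.continuous.comp (Continuous.prodMk_right z)).aestronglyMeasurable
    · exact (hF.continuous.comp (Continuous.prodMk_right z₀)).intervalIntegrable _ _
    · exact (hF'c.continuous.comp (Continuous.prodMk_right z₀)).aestronglyMeasurable
    · refine Eventually.of_forall fun s hs z hz => hK (z, s) ⟨Metric.ball_subset_closedBall hz, ?_⟩
      rw [Set.uIoc_of_le zero_le_one] at hs
      exact ⟨hs.1.le, hs.2⟩
    · exact intervalIntegrable_const
    · exact Eventually.of_forall fun s _ z _ => hd z s

theorem taylor_two_integral_remainder {f f' f'' : ℝ → ℝ} (hf : ∀ x, HasDerivAt f (f' x) x)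
    (hf' : ∀ x, HasDerivAt f' (f'' x) x) (hc : Continuous f'') (v : ℝ) :
    f v = f 0 + f' 0 * v + (∫ s in (0 : ℝ)..1, 2 * (1 - s) * f'' (s * v)) * (v ^ 2 / 2) := by
  have hd : ∀ s ∈ Set.uIcc (0 : ℝ) 1,
      -- This primitive absorbs the integration by parts: the two `v f'(sv)` terms cancel.
      HasDerivAt (fun s => (1 - s) * v * f' (s * v) + f (s * v))
        (2 * (1 - s) * f'' (s * v) * (v ^ 2 / 2)) s := by
    intro s _
    have hs : HasDerivAt (fun s : ℝ => s * v) v s := by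
      simpa using (hasDerivAt_id s).mul_const v
    have h1 : HasDerivAt (fun s : ℝ => (1 - s) * v) (-v) s := by
      simpa using ((hasDerivAt_id s).const_sub 1).mul_const v
    have h2 := (h1.mul ((hf' (s * v)).comp s hs)).add ((hf (s * v)).comp s hs)
    refine h2.congr_deriv ?_
    simp only [Function.comp_apply]
    ring
  have h := intervalIntegral.integral_eq_sub_of_hasDerivAt hd
    (Continuous.intervalIntegrable (by fun_prop) _ _)
  rw [intervalIntegral.integral_mul_const] at h
  rw [h]
  simp only [sub_self, zero_mul, one_mul, sub_zero, zero_add]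
  ring

namespace TimeScale

/-! ### Delta calculus on isolated time scales -/

section Isolated

variable {T : Set ℝ} {E : Type*} [NormedAddCommGroup E] [NormedSpace ℝ E]

theorem IsIsolated.mono {S : Set ℝ} (hT : IsIsolated T) (h : S ⊆ T) : IsIsolated S := by
  intro t ht
  obtain ⟨δ, hδ, he⟩ := hT t (h ht)
  refine ⟨δ, hδ, Set.Subset.antisymm ?_ ?_⟩
  · rw [← he]
    exact Set.inter_subset_inter_right _ h
  · rintro _ rfl
    exact ⟨⟨by linarith, by linarith⟩, ht⟩

theorem IsIsolated.nhdsWithin_eq (hT : IsIsolated T) {t : ℝ} (ht : t ∈ T) :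
    𝓝[T] t = pure t := by
  obtain ⟨δ, hδ, he⟩ := hT t ht
  rw [nhdsWithin_restrict' T (Ioo_mem_nhds (sub_lt_self t hδ) (lt_add_of_pos_right t hδ)),
    Set.inter_comm, he, nhdsWithin_singleton]

theorem IsIsolated.finite_inter_Icc (hT : IsIsolated T) (hc : IsClosed T) (x y : ℝ) :
    (Set.Icc x y ∩ T).Finite :=
  (isCompact_Icc.inter_right hc).finite (isDiscrete_iff_nhdsWithin.2 fun _ ht =>
    (hT.mono Set.inter_subset_right).nhdsWithin_eq ht)

theorem IsIsolated.rdContinuous {F : Type*} [NormedAddCommGroup F] (hT : IsIsolated T)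
    (f : ℝ → F) : RdContinuous T f := by
  refine ⟨fun t ht _ => ?_, fun t ht _ => ⟨0, ?_⟩⟩
  · rw [ContinuousWithinAt, hT.nhdsWithin_eq ht]
    exact tendsto_pure_nhds f t
  · have : 𝓝[T ∩ Set.Iio t] t = ⊥ := by
      rw [nhdsWithin_inter', hT.nhdsWithin_eq ht, ← principal_singleton, inf_principal]
      simp
    rw [this]
    exact tendsto_bot

/-- Near `t` the only point of `T` is `t` itself, so the estimate is tested at `s = t` alone, for
every `ε`. If `μ(t) = 0`, every `f'` qualifies, which is why `deltaDeriv_eq` needs `μ(t) ≠ 0`. -/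
theorem IsIsolated.hasDeltaDerivAt_iff (hT : IsIsolated T) {t : ℝ} (ht : t ∈ T) (f : ℝ → E)
    (f' : E) : HasDeltaDerivAt T f f' t ↔ f (sigma T t) - f t = mu T t • f' := by
  simp only [HasDeltaDerivAt, hT.nhdsWithin_eq ht, eventually_pure]
  constructor
  · intro h
    rw [← sub_eq_zero, ← norm_le_zero_iff]
    by_contra! hpos
    have h0 : 0 < |mu T t| + 1 := by positivity
    have := h (‖f (sigma T t) - f t - mu T t • f'‖ / (2 * (|mu T t| + 1))) (by positivity)
    change ‖f (sigma T t) - f t - mu T t • f'‖ ≤ _ * |mu T t| at this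
    rw [div_mul_eq_mul_div, le_div_iff₀ (by positivity)] at this
    nlinarith [abs_nonneg (mu T t)]
  · intro h ε hε
    rw [h, mu, sub_self, norm_zero]
    positivity

theorem IsIsolated.exists_hasDeltaDerivAt (hT : IsIsolated T) {t : ℝ} (ht : t ∈ T)
    (f : ℝ → E) : ∃ f', HasDeltaDerivAt T f f' t := by
  by_cases h : mu T t = 0
  · refine ⟨0, (hT.hasDeltaDerivAt_iff ht f 0).2 ?_⟩
    rw [sub_eq_zero.1 h]
    simp
  · exact ⟨(mu T t)⁻¹ • (f (sigma T t) - f t),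
      (hT.hasDeltaDerivAt_iff ht f _).2 (by rw [smul_inv_smul₀ h])⟩

theorem IsIsolated.deltaDeriv_eq (hT : IsIsolated T) {t : ℝ} (ht : t ∈ T) (hμ : mu T t ≠ 0)
    {f : ℝ → E} {f' : E} (h : f (sigma T t) - f t = mu T t • f') : deltaDeriv T f t = f' := by
  have hex : ∃ f', HasDeltaDerivAt T f f' t := hT.exists_hasDeltaDerivAt ht f
  have := (hT.hasDeltaDerivAt_iff ht f _).1 hex.choose_spec
  rw [deltaDeriv, dif_pos hex]
  exact smul_right_injective E hμ (this.symm.trans h)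

theorem kappa_subset (T : Set ℝ) : kappa T ⊆ T := fun _ h => h.1

theorem IsIsolated.c1rd (hT : IsIsolated T) (f : ℝ → E) : C1rd T f :=
  ⟨fun _ ht => hT.exists_hasDeltaDerivAt ht.1 f, (hT.mono (kappa_subset T)).rdContinuous _⟩

theorem mem_kappa_of_lt {s t : ℝ} (ht : t ∈ T) (hs : s ∈ T) (hts : t < s) : t ∈ kappa T :=
  ⟨ht, fun h => (h.1.2 hs).not_gt hts⟩

/-- In a finite set a maximum with something below it is left-scattered, because the supremum
defining `ρ` is attained. The point `s` excludes singletons, where `κ` removes nothing. -/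
theorem exists_gt_of_mem_kappa_of_finite (hf : T.Finite) {s t : ℝ} (hs : s ∈ T) (hst : s < t)
    (ht : t ∈ kappa T) : ∃ u ∈ T, t < u := by
  by_contra! h
  refine ht.2 ⟨⟨ht.1, h⟩, ?_⟩
  rw [rho, if_neg fun hl => (hl.2 hs).not_gt hst]
  have hfin : {u ∈ T | u < t}.Finite := hf.subset fun u hu => hu.1
  have hne : {u ∈ T | u < t}.Nonempty := ⟨s, hs, hst⟩
  exact (hne.csSup_mem hfin).2

theorem sigma_le {s t : ℝ} (hs : s ∈ T) (hts : t < s) : sigma T t ≤ s := by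
  rw [sigma, if_neg fun h => (h.2 hs).not_gt hts]
  exact csInf_le ⟨t, fun _ h => h.2.le⟩ ⟨hs, hts⟩

theorem sigma_mem (hc : IsClosed T) {s t : ℝ} (hs : s ∈ T) (hts : t < s) : sigma T t ∈ T := by
  rw [sigma, if_neg fun h => (h.2 hs).not_gt hts]
  exact closure_minimal (fun _ h => h.1) hc (csInf_mem_closure ⟨s, hs, hts⟩
    ⟨t, fun _ h => h.2.le⟩)

theorem IsIsolated.lt_sigma (hT : IsIsolated T) {s t : ℝ} (ht : t ∈ T) (hs : s ∈ T)
    (hts : t < s) : t < sigma T t := by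
  rw [sigma, if_neg fun h => (h.2 hs).not_gt hts]
  obtain ⟨δ, hδ, he⟩ := hT t ht
  refine (lt_add_of_pos_right t hδ).trans_le (le_csInf ⟨s, hs, hts⟩ fun u hu => ?_)
  by_contra! hlt
  have : u ∈ Set.Ioo (t - δ) (t + δ) ∩ T := ⟨⟨by linarith [hu.2], hlt⟩, hu.1⟩
  rw [he] at this
  exact hu.2.ne' this

theorem IsIsolated.mu_pos (hT : IsIsolated T) {s t : ℝ} (ht : t ∈ T) (hs : s ∈ T)
    (hts : t < s) : 0 < mu T t :=
  sub_pos.2 (hT.lt_sigma ht hs hts)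

theorem IsIsolated.exists_sigma_eq (hT : IsIsolated T) (hc : IsClosed T) {s t : ℝ} (hs : s ∈ T)
    (ht : t ∈ T) (hst : s < t) : ∃ u ∈ T, s ≤ u ∧ u < t ∧ sigma T u = t := by
  have hfin : (Set.Icc s t ∩ T ∩ Set.Iio t).Finite :=
    (hT.finite_inter_Icc hc s t).subset Set.inter_subset_left
  obtain ⟨u, hu, hmax⟩ := hfin.exists_maximal ⟨s, ⟨⟨le_rfl, hst.le⟩, hs⟩, hst⟩
  have hut : u < t := hu.2
  refine ⟨u, hu.1.2, hu.1.1.1, hut, (sigma_le ht hut).antisymm ?_⟩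
  by_contra! hlt
  have hlt' := hT.lt_sigma hu.1.2 ht hut
  exact hlt'.not_ge (hmax ⟨⟨⟨hu.1.1.1.trans hlt'.le, hlt.le⟩, sigma_mem hc ht hut⟩, hlt⟩ hlt'.le)

/-- A least counterexample exists by finiteness, and it is the jump of an earlier point. -/
theorem IsIsolated.induction_sigma (hT : IsIsolated T) (hc : IsClosed T) {s b : ℝ} (hs : s ∈ T)
    {p : ℝ → Prop} (h0 : p s)
    (hstep : ∀ t ∈ T, s ≤ t → t < b → p t → p (sigma T t)) :
    ∀ t ∈ T, s ≤ t → t ≤ b → p t := by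
  by_contra! hne
  obtain ⟨t, ht, hst, htb, hpt⟩ := hne
  have hfin : (Set.Icc s b ∩ T ∩ {t | ¬ p t}).Finite :=
    (hT.finite_inter_Icc hc s b).subset Set.inter_subset_left
  obtain ⟨m, hm, hmin⟩ := hfin.exists_minimal ⟨t, ⟨⟨hst, htb⟩, ht⟩, hpt⟩
  have hsm : s < m := hm.1.1.1.lt_of_ne (by rintro rfl; exact hm.2 h0)
  obtain ⟨u, hu, hsu, hum, rfl⟩ := hT.exists_sigma_eq hc hs hm.1.2 hsm
  by_cases hpu : p u
  · exact hm.2 (hstep u hu hsu (hum.trans_le hm.1.1.2) hpu)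
  · exact hum.not_ge (hmin ⟨⟨⟨hsu, hum.le.trans hm.1.1.2⟩, hu⟩, hpu⟩ hum.le)

theorem IsIsolated.exists_isAntiderivative (hT : IsIsolated T) (hc : IsClosed T) (f : ℝ → E) :
    ∃ F, IsAntiderivative T F f := by
  rcases T.eq_empty_or_nonempty with rfl | ⟨a, ha⟩
  · exact ⟨0, fun t ht => ht.1.elim⟩
  have hfin : ∀ x y, (Set.Ico x y ∩ T).Finite := fun x y =>
    (hT.finite_inter_Icc hc x y).subset (Set.inter_subset_inter_left _ Set.Ico_subset_Icc_self)
  -- `T` may be unbounded on both sides, so the sum is signed from a base point; on each side it is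
  -- finite.
  refine ⟨fun t => ∑ᶠ τ ∈ Set.Ico a t ∩ T, mu T τ • f τ - ∑ᶠ τ ∈ Set.Ico t a ∩ T, mu T τ • f τ,
    fun t ht => (hT.hasDeltaDerivAt_iff ht.1 _ _).2 ?_⟩
  by_cases hmax : ∃ s ∈ T, t < s
  swap
  · have hg : IsGreatest T t := ⟨ht.1, fun s hs => not_lt.1 fun h => hmax ⟨s, hs, h⟩⟩
    have : sigma T t = t := if_pos hg
    simp [mu, this]
  obtain ⟨s, hs, hts⟩ := hmax
  have hlt := hT.lt_sigma ht.1 hs hts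
  rcases le_or_gt a t with hat | hta
  · have h1 : Set.Ico a (sigma T t) ∩ T = insert t (Set.Ico a t ∩ T) := by
      ext u
      simp only [Set.mem_inter_iff, Set.mem_Ico, Set.mem_insert_iff]
      constructor
      · rintro ⟨⟨h1, h2⟩, h3⟩
        rcases lt_trichotomy u t with h | h | h
        · exact Or.inr ⟨⟨h1, h⟩, h3⟩
        · exact Or.inl h
        · exact absurd (sigma_le h3 h) h2.not_ge
      · rintro (rfl | ⟨⟨h1, h2⟩, h3⟩)
        · exact ⟨⟨hat, hlt⟩, ht.1⟩
        · exact ⟨⟨h1, h2.trans hlt⟩, h3⟩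
    rw [h1, finsum_mem_insert _ (by simp) (hfin a t), Set.Ico_eq_empty hat.not_gt,
      Set.Ico_eq_empty (hat.trans hlt.le).not_gt]
    simp
  · have haT : sigma T t ≤ a := sigma_le ha hta
    have h1 : Set.Ico t a ∩ T = insert t (Set.Ico (sigma T t) a ∩ T) := by
      ext u
      simp only [Set.mem_inter_iff, Set.mem_Ico, Set.mem_insert_iff]
      constructor
      · rintro ⟨⟨h1, h2⟩, h3⟩
        rcases h1.eq_or_lt with h | h
        · exact Or.inl h.symm
        · exact Or.inr ⟨⟨sigma_le h3 h, h2⟩, h3⟩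
      · rintro (rfl | ⟨⟨h1, h2⟩, h3⟩)
        · exact ⟨⟨le_rfl, hta⟩, ht.1⟩
        · exact ⟨⟨hlt.le.trans h1, h2⟩, h3⟩
    rw [h1, finsum_mem_insert _ (by simp [hlt]) (hfin _ a), Set.Ico_eq_empty hta.not_gt,
      Set.Ico_eq_empty haT.not_gt]
    simp

theorem deltaIntegral_self (T : Set ℝ) (f : ℝ → E) (s : ℝ) : deltaIntegral T f s s = 0 := by
  rw [deltaIntegral]
  split_ifs <;> simp

theorem IsIsolated.deltaIntegral_sigma (hT : IsIsolated T) (hc : IsClosed T) (f : ℝ → E)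
    (s : ℝ) {t : ℝ} (ht : t ∈ kappa T) :
    deltaIntegral T f s (sigma T t) = deltaIntegral T f s t + mu T t • f t := by
  have hex := hT.exists_isAntiderivative hc f
  have h := (hT.hasDeltaDerivAt_iff ht.1 _ _).1 (hex.choose_spec t ht)
  rw [deltaIntegral, deltaIntegral, dif_pos hex, dif_pos hex, ← h]
  abel

end Isolated
-- The interval and its truncations
section Interval

variable {T : Set ℝ} {a b : ℝ}

theorem IsIsolated.interval_finite (hT : IsIsolated T) (hc : IsClosed T) (a b : ℝ) :
    (interval T a b).Finite :=
  hT.finite_inter_Icc hc a b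

theorem IsIsolated.isIsolated_interval (hT : IsIsolated T) (a b : ℝ) : IsIsolated (interval T a b) :=
  hT.mono Set.inter_subset_right

theorem IsIsolated.rdAlongPaths (hT : IsIsolated T) (a b : ℝ) (f : ℝ → ℝ → ℝ → ℝ) :
    RdAlongPaths T a b f :=
  fun _ _ => ((hT.isIsolated_interval a b).mono (kappa_subset _)).rdContinuous _

theorem IsIsolated.mem_kappa_interval_iff (hT : IsIsolated T) (hc : IsClosed T) (ha : a ∈ T)
    (hb : b ∈ T) (hab : a < b) {t : ℝ} :
    t ∈ kappa (interval T a b) ↔ t ∈ T ∧ a ≤ t ∧ t < b := by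
  have hbS : b ∈ interval T a b := ⟨⟨hab.le, le_rfl⟩, hb⟩
  constructor
  · intro h
    refine ⟨h.1.2, h.1.1.1, h.1.1.2.lt_of_ne ?_⟩
    rintro rfl
    obtain ⟨u, hu, htu⟩ := exists_gt_of_mem_kappa_of_finite (hT.interval_finite hc a t)
      ⟨⟨le_rfl, hab.le⟩, ha⟩ hab h
    exact hu.1.2.not_gt htu
  · rintro ⟨h1, h2, h3⟩
    exact mem_kappa_of_lt ⟨⟨h2, h3.le⟩, h1⟩ hbS h3

theorem IsIsolated.mem_kappa_kappa_interval (hT : IsIsolated T) (hc : IsClosed T) (ha : a ∈ T)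
    (hb : b ∈ T) (hab : a < b) {s t : ℝ} (hs : s ∈ T) (has : a ≤ s) (hst : s < t)
    (ht : t ∈ kappa (interval T a b)) :
    s ∈ kappa (kappa (interval T a b)) := by
  have h := (hT.mem_kappa_interval_iff hc ha hb hab).1 ht
  exact mem_kappa_of_lt ((hT.mem_kappa_interval_iff hc ha hb hab).2
    ⟨hs, has, hst.trans h.2.2⟩) ht hst

/-- This makes `μ(σ(t)) > 0`. The delicate case is `[a,b]_T = {a,b}`: then `κ` gives `{a}`, a second
`κ` removes nothing, and `σ(a) = b` needs a point of `T` beyond `b`. -/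
theorem IsIsolated.exists_gt_sigma (hT : IsIsolated T) (hc : IsClosed T) (ha : a ∈ T)
    (hb : b ∈ T) (hab : a < b) (h3 : ∃ c ∈ T, ∃ d ∈ T, a < c ∧ c < d) {t : ℝ}
    (ht : t ∈ kappa (kappa (interval T a b))) : ∃ d ∈ T, sigma T t < d := by
  have h := (hT.mem_kappa_interval_iff hc ha hb hab).1 ht.1
  rcases (sigma_le hb h.2.2).lt_or_eq with hlt | heq
  · exact ⟨b, hb, hlt⟩
  rcases h.2.1.lt_or_eq with hat | rfl
  · obtain ⟨u, hu, htu⟩ := exists_gt_of_mem_kappa_of_finite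
      ((hT.interval_finite hc a b).subset (kappa_subset _))
      ((hT.mem_kappa_interval_iff hc ha hb hab).2 ⟨ha, le_rfl, hab⟩) hat ht
    have hu' := (hT.mem_kappa_interval_iff hc ha hb hab).1 hu
    exact ⟨b, hb, (sigma_le hu'.1 htu).trans_lt hu'.2.2⟩
  · obtain ⟨c, hcT, d, hd, hac, hcd⟩ := h3
    exact ⟨d, hd, (sigma_le hcT hac).trans_lt hcd⟩

theorem uniformlyContDiff_iff_of_finite {V : Type*} [NormedAddCommGroup V] [NormedSpace ℝ V]
    {k : ℕ} {S : Set ℝ} (hS : S.Finite) {f : ℝ → V → ℝ} :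
    UniformlyContDiff k S f ↔ ∀ t ∈ S, ContDiff ℝ k (f t) := by
  refine ⟨fun h => h.1, fun h => ⟨h, fun j hj => ?_⟩⟩
  have : Finite S := hS
  exact equicontinuous_finite.2 fun t =>
    (h t t.2).continuous_iteratedFDeriv (by exact_mod_cast hj)

end Interval

/-! ### Integrals, the exponential, variation of constants -/

section Integral

variable {T : Set ℝ} {s b : ℝ}

theorem IsIsolated.deltaIntegral_eq_of_step (hT : IsIsolated T) (hc : IsClosed T) (hs : s ∈ T)
    (hb : b ∈ T) {f G : ℝ → ℝ} (h0 : G s = 0)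
    (hstep : ∀ t ∈ T, s ≤ t → t < b → G (sigma T t) = G t + mu T t * f t) :
    ∀ t ∈ T, s ≤ t → t ≤ b → deltaIntegral T f s t = G t := by
  refine hT.induction_sigma hc hs (by rw [deltaIntegral_self, h0]) fun t ht hst htb h => ?_
  rw [hT.deltaIntegral_sigma hc f s (mem_kappa_of_lt ht hb htb), h, hstep t ht hst htb, smul_eq_mul]

theorem IsIsolated.hasDerivAt_deltaIntegral (hT : IsIsolated T) (hc : IsClosed T) (hs : s ∈ T)
    (hb : b ∈ T) {f : ℝ → ℝ → ℝ} {f' : ℝ → ℝ} {x : ℝ}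
    (hf : ∀ t ∈ T, s ≤ t → t < b → HasDerivAt (fun ε => f ε t) (f' t) x) :
    ∀ t ∈ T, s ≤ t → t ≤ b →
      HasDerivAt (fun ε => deltaIntegral T (f ε) s t) (deltaIntegral T f' s t) x := by
  refine hT.induction_sigma hc hs ?_ fun t ht hst htb h => ?_
  · simp only [deltaIntegral_self]
    exact hasDerivAt_const x 0
  · simp only [hT.deltaIntegral_sigma hc _ s (mem_kappa_of_lt ht hb htb), smul_eq_mul]
    exact h.add ((hf t ht hst htb).const_mul _)

theorem IsIsolated.eq_zero_of_deltaIntegral_eq_zero (hT : IsIsolated T) (hc : IsClosed T)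
    (hs : s ∈ T) (hb : b ∈ T) {f : ℝ → ℝ} (hf : ∀ t, 0 ≤ f t) :
    ∀ t ∈ T, s ≤ t → t ≤ b → 0 ≤ deltaIntegral T f s t ∧
      (deltaIntegral T f s t = 0 → ∀ τ ∈ T, s ≤ τ → τ < t → f τ = 0) := by
  refine hT.induction_sigma hc hs ?_ fun t ht hst htb h => ?_
  · simp only [deltaIntegral_self]
    exact ⟨le_rfl, fun _ τ _ h1 h2 => absurd h1 h2.not_ge⟩
  · rw [hT.deltaIntegral_sigma hc _ s (mem_kappa_of_lt ht hb htb), smul_eq_mul]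
    have hμ := hT.mu_pos ht hb htb
    have h1 : 0 ≤ mu T t * f t := mul_nonneg hμ.le (hf t)
    refine ⟨add_nonneg h.1 h1, fun h0 τ hτ hsτ hτt => ?_⟩
    have h2 := (add_eq_zero_iff_of_nonneg h.1 h1).1 h0
    rcases lt_trichotomy τ t with hlt | rfl | hgt
    · exact h.2 h2.1 τ hτ hsτ hlt
    · exact (mul_eq_zero.1 h2.2).resolve_left hμ.ne'
    · exact absurd (sigma_le hτ hgt) hτt.not_ge

theorem timeExp_self (T : Set ℝ) (p : ℝ → ℝ) (t : ℝ) : timeExp T p t t = 1 := by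
  simp [timeExp, deltaIntegral_self]

/-- One step multiplies the complex exponential by `exp Log(1 + μp) = 1 + μp`. This factor is real
even when the logarithm is not, so it passes through `re`. -/
theorem IsIsolated.timeExp_sigma (hT : IsIsolated T) (hc : IsClosed T) (p : ℝ → ℝ) (s : ℝ)
    {t : ℝ} (ht : t ∈ kappa T) (hμ : mu T t ≠ 0) (hp : 1 + mu T t * p t ≠ 0) :
    timeExp T p (sigma T t) s = (1 + mu T t * p t) * timeExp T p t s := by
  have h : Complex.exp (mu T t • cylinder (mu T t) (p t : ℂ)) = ((1 + mu T t * p t : ℝ) : ℂ) := by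
    have hμ' : (mu T t : ℂ) ≠ 0 := by exact_mod_cast hμ
    rw [cylinder, if_neg hμ, Complex.real_smul, mul_div_cancel₀ _ hμ', Complex.exp_log]
    · push_cast; rfl
    · exact_mod_cast hp
  rw [timeExp, hT.deltaIntegral_sigma hc _ s ht, Complex.exp_add, h, Complex.re_mul_ofReal,
    mul_comm, timeExp]

theorem IsIsolated.eq_timeExp_mul_add (hT : IsIsolated T) (hc : IsClosed T)
    (hs : s ∈ T) (hb : b ∈ T) {X r f : ℝ → ℝ}
    (hr : ∀ t ∈ T, s ≤ t → t < b → 1 + mu T t * r t ≠ 0)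
    (hX : ∀ t ∈ T, s ≤ t → t < b → X (sigma T t) = X t + mu T t * (r t * X t + f t)) :
    ∀ t ∈ T, s ≤ t → t ≤ b → X t = timeExp T r t s * X s +
      deltaIntegral T (fun τ => timeExp T r t (sigma T τ) * f τ) s t := by
  refine hT.induction_sigma hc hs (by simp [timeExp_self, deltaIntegral_self])
    fun t ht hst htb h => ?_
  have hk := mem_kappa_of_lt ht hb htb
  have hμ := (hT.mu_pos ht hb htb).ne'
  have he : ∀ u, timeExp T r (sigma T t) u = (1 + mu T t * r t) * timeExp T r t u :=
    fun u => hT.timeExp_sigma hc r u hk hμ (hr t ht hst htb)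
  -- The integrand also depends on the upper endpoint; moving that endpoint to `σ(t)` pulls out the
  -- factor `1 + μ(t) r(t)`.
  have hI := hT.deltaIntegral_eq_of_step hc hs hb
    (f := fun τ => timeExp T r (sigma T t) (sigma T τ) * f τ)
    (G := fun u => (1 + mu T t * r t) *
      deltaIntegral T (fun τ => timeExp T r t (sigma T τ) * f τ) s u)
    (by simp [deltaIntegral_self]) (fun τ hτ hsτ hτb => by
      rw [hT.deltaIntegral_sigma hc _ s (mem_kappa_of_lt hτ hb hτb), he, smul_eq_mul]
      ring) t ht hst htb.le
  rw [hT.deltaIntegral_sigma hc _ s hk, hI, hX t ht hst htb, timeExp_self, he, smul_eq_mul]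
  linear_combination (1 + mu T t * r t) * h

end Integral

/-! ### Expansion of the Lagrangian -/

section Lagrangian

theorem hasDerivAt_snd_of_contDiff {g : ℝ → ℝ → ℝ} {n : ℕ}
    (hg : ContDiff ℝ (n + 1 : ℕ) fun z : ℝ × ℝ => g z.1 z.2) (x v : ℝ) :
    HasDerivAt (g x) (fderiv ℝ (fun z : ℝ × ℝ => g z.1 z.2) (x, v) (0, 1)) v := by
  have h := ((hg.differentiable (by simp)).differentiableAt.hasFDerivAt (x := (x, v)))
  exact h.comp_hasDerivAt v ((hasDerivAt_const v x).prodMk (hasDerivAt_id v))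

theorem contDiff_deriv_snd {g : ℝ → ℝ → ℝ} {n : ℕ}
    (hg : ContDiff ℝ (n + 1 : ℕ) fun z : ℝ × ℝ => g z.1 z.2) :
    ContDiff ℝ n fun z : ℝ × ℝ => deriv (g z.1) z.2 := by
  have h : (fun z : ℝ × ℝ => deriv (g z.1) z.2) =
      fun z => fderiv ℝ (fun z : ℝ × ℝ => g z.1 z.2) z (0, 1) :=
    funext fun z => (hasDerivAt_snd_of_contDiff hg z.1 z.2).deriv
  rw [h]
  exact (hg.fderiv_right (m := n) (by norm_cast)).clm_apply contDiff_const

/-- The coefficient `2 ∫₀¹ (1 - s) L_vv(t, x, s v) ds` of `v² / 2` in the expansion of `L` at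
`v = 0`. -/
noncomputable def remainderCoeff (L : ℝ → ℝ → ℝ → ℝ) (t x v : ℝ) : ℝ :=
  ∫ s in (0 : ℝ)..1, 2 * (1 - s) * Lvv L t x (s * v)

theorem contDiff_remainderCoeff {L : ℝ → ℝ → ℝ → ℝ} {t : ℝ} {n : ℕ}
    (h : ContDiff ℝ n fun z : ℝ × ℝ => Lvv L t z.1 z.2) :
    ContDiff ℝ n fun z : ℝ × ℝ => remainderCoeff L t z.1 z.2 := by
  refine contDiff_intervalIntegral_param n
    (F := fun z : (ℝ × ℝ) × ℝ => 2 * (1 - z.2) * Lvv L t z.1.1 (z.2 * z.1.2)) ?_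
  have h1 : ContDiff ℝ n fun z : (ℝ × ℝ) × ℝ => ((z.1.1, z.2 * z.1.2) : ℝ × ℝ) := by fun_prop
  have h2 := h.comp h1
  simp only [Function.comp_def] at h2
  fun_prop

theorem remainderCoeff_zero (L : ℝ → ℝ → ℝ → ℝ) (t x : ℝ) :
    remainderCoeff L t x 0 = Lvv L t x 0 := by
  have h : ∫ s in (0 : ℝ)..1, 2 * (1 - s) = 1 := by
    rw [intervalIntegral.integral_const_mul, intervalIntegral.integral_sub (by simp) (by simp)]
    simp
    norm_num
  simp only [remainderCoeff, mul_zero]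
  rw [intervalIntegral.integral_mul_const, h, one_mul]

theorem eq_add_remainderCoeff {L : ℝ → ℝ → ℝ → ℝ} {t : ℝ}
    (h : ContDiff ℝ 2 fun z : ℝ × ℝ => L t z.1 z.2) (x v : ℝ) :
    L t x v = coeffP L t x + coeffQ L t x * v + remainderCoeff L t x v * (v ^ 2 / 2) := by
  have h1 : ContDiff ℝ (1 : ℕ) fun z : ℝ × ℝ => Lv L t z.1 z.2 :=
    contDiff_deriv_snd (n := 1) h
  have h2 : ContDiff ℝ (0 : ℕ) fun z : ℝ × ℝ => Lvv L t z.1 z.2 :=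
    contDiff_deriv_snd (n := 0) h1
  exact taylor_two_integral_remainder
    (fun u => (hasDerivAt_snd_of_contDiff (n := 1) h x u).differentiableAt.hasDerivAt)
    (fun u => (hasDerivAt_snd_of_contDiff (n := 0) h1 x u).differentiableAt.hasDerivAt)
    (h2.continuous.comp (Continuous.prodMk_right x)) v

theorem hasDerivAt_along_line {L : ℝ → ℝ → ℝ → ℝ} {t : ℝ}
    (h : ContDiff ℝ 2 fun z : ℝ × ℝ => L t z.1 z.2) (x v : ℝ) :
    HasDerivAt (fun ε => L t (ε * x) (ε * v)) (Px0 L t * x + coeffQ L t 0 * v) 0 := by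
  have hF : HasFDerivAt (fun z : ℝ × ℝ => L t z.1 z.2) _ ((0 : ℝ), (0 : ℝ)) :=
    (h.differentiable (by simp)).differentiableAt.hasFDerivAt
  have hx : Px0 L t = fderiv ℝ (fun z : ℝ × ℝ => L t z.1 z.2) (0, 0) (1, 0) :=
    (hF.comp_hasDerivAt (f := fun x : ℝ => (x, (0 : ℝ))) (0 : ℝ)
      ((hasDerivAt_id (0 : ℝ)).prodMk (hasDerivAt_const (0 : ℝ) (0 : ℝ)))).deriv
  have hv : coeffQ L t 0 = fderiv ℝ (fun z : ℝ × ℝ => L t z.1 z.2) (0, 0) (0, 1) :=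
    (hasDerivAt_snd_of_contDiff (n := 1) h 0 0).deriv
  have hline : HasDerivAt (fun ε : ℝ => (ε * x, ε * v)) (x, v) 0 := by
    simpa using ((hasDerivAt_id (0 : ℝ)).mul_const x).prodMk
      ((hasDerivAt_id (0 : ℝ)).mul_const v)
  have hF' : HasFDerivAt (fun z : ℝ × ℝ => L t z.1 z.2)
      (fderiv ℝ (fun z : ℝ × ℝ => L t z.1 z.2) (0, 0)) ((0 : ℝ) * x, (0 : ℝ) * v) := by
    simpa using hF
  refine (hF'.comp_hasDerivAt (0 : ℝ) hline).congr_deriv ?_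
  have : ((x, v) : ℝ × ℝ) = x • (1, 0) + v • (0, 1) := by simp
  rw [this, map_add, map_smul, map_smul, ← hx, ← hv, smul_eq_mul, smul_eq_mul]
  ring

end Lagrangian

/-! ### First variation and the Euler-Lagrange equation -/

section EulerLagrange

variable {T : Set ℝ} {a b : ℝ} {L : ℝ → ℝ → ℝ → ℝ}

theorem IsIsolated.deltaDeriv_const_mul (hT : IsIsolated T) (hb : b ∈ T) {t : ℝ} (ht : t ∈ T)
    (htb : t < b) (ε : ℝ) (η : ℝ → ℝ) :
    deltaDeriv T (fun u => ε * η u) t = ε * deltaDeriv T η t := by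
  have hμ := (hT.mu_pos ht hb htb).ne'
  have h : η (sigma T t) - η t = mu T t • ((mu T t)⁻¹ * (η (sigma T t) - η t)) := by
    rw [smul_eq_mul, mul_inv_cancel_left₀ hμ]
  rw [hT.deltaDeriv_eq ht hμ h]
  refine hT.deltaDeriv_eq ht hμ ?_
  rw [smul_eq_mul]
  field_simp

theorem IsIsolated.c1Norm_le (hT : IsIsolated T) (hc : IsClosed T) (ha : a ∈ T) (hb : b ∈ T)
    (hab : a < b) (η : ℝ → ℝ) :
    ∃ K, 0 ≤ K ∧ ∀ ε : ℝ, c1Norm T a b (fun t => ε * η t) ≤ |ε| * K := by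
  have hfin : (kappa (interval T a b)).Finite :=
    (hT.interval_finite hc a b).subset (kappa_subset _)
  obtain ⟨K₁, h1⟩ := (hfin.image fun t => |η (sigma T t)|).bddAbove
  obtain ⟨K₂, h2⟩ := (hfin.image fun t => |deltaDeriv T η t|).bddAbove
  refine ⟨max K₁ 0 + max K₂ 0, by positivity, fun ε => ?_⟩
  rw [mul_add, c1Norm]
  refine add_le_add (Real.sSup_le ?_ (by positivity)) (Real.sSup_le ?_ (by positivity))
  · rintro _ ⟨t, ht, rfl⟩
    simp only [abs_mul]
    exact mul_le_mul_of_nonneg_left ((h1 ⟨t, ht, rfl⟩).trans (le_max_left _ _)) (abs_nonneg ε)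
  · rintro _ ⟨t, ht, rfl⟩
    have ht' := (hT.mem_kappa_interval_iff hc ha hb hab).1 ht
    have hd : deltaDeriv T (fun t => ε * η t) t = ε * deltaDeriv T η t :=
      hT.deltaDeriv_const_mul hb ht'.1 ht'.2.2 ε η
    simp only [hd, abs_mul]
    exact mul_le_mul_of_nonneg_left ((h2 ⟨t, ht, rfl⟩).trans (le_max_left _ _)) (abs_nonneg ε)

/-- The variations `εη` are admissible and small in norm for small `ε`, so `ε = 0` is a local
minimum of a real function whose derivative is this integral. -/
theorem IsIsolated.firstVariation_eq_zero (hT : IsIsolated T) (hc : IsClosed T) (ha : a ∈ T)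
    (hb : b ∈ T) (hab : a < b)
    (hL : ∀ t ∈ interval T a b, ContDiff ℝ 2 fun z : ℝ × ℝ => L t z.1 z.2)
    (hmin : IsLocalMinimizer T a b 0 0 L (fun _ => 0)) {η : ℝ → ℝ} (hηa : η a = 0)
    (hηb : η b = 0) :
    deltaIntegral T (fun t => Px0 L t * η (sigma T t) + coeffQ L t 0 * deltaDeriv T η t) a b
      = 0 := by
  have hder := hT.hasDerivAt_deltaIntegral hc ha hb (x := 0)
    (f := fun ε t => L t (ε * η (sigma T t)) (deltaDeriv T (fun t => ε * η t) t))
    (f' := fun t => Px0 L t * η (sigma T t) + coeffQ L t 0 * deltaDeriv T η t)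
    (fun t ht hat htb => by
      simp only [hT.deltaDeriv_const_mul hb ht htb]
      exact hasDerivAt_along_line (hL t ⟨⟨hat, htb.le⟩, ht⟩) _ _) b hb hab.le le_rfl
  refine IsLocalMin.hasDerivAt_eq_zero ?_ hder
  obtain ⟨-, δ, hδ, hle⟩ := hmin
  obtain ⟨K, hK, hn⟩ := hT.c1Norm_le hc ha hb hab η
  have hev : ∀ᶠ ε : ℝ in 𝓝 0, |ε| * K < δ := by
    have : Tendsto (fun ε : ℝ => |ε| * K) (𝓝 0) (𝓝 (|0| * K)) :=
      (continuous_abs.mul continuous_const).tendsto 0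
    exact this.eventually_lt_const (by simpa using hδ)
  filter_upwards [hev] with ε hε
  have := hle (fun t => ε * η t) ⟨hT.c1rd _, by simp [hηa], by simp [hηb]⟩
    (by simpa using (hn ε).trans_lt hε)
  simpa [functional] using this

/-- Du Bois-Reymond's argument: test with the `η` whose derivative is `g - c`, where `g = Q(·,0) - ∫
P_x` and `c` is the mean of `g`, chosen so that `η(b) = 0`. The first variation becomes `∫ (g - c)²
Δt`. -/
theorem IsIsolated.eulerLagrange (hT : IsIsolated T) (hc : IsClosed T) (ha : a ∈ T)
    (hb : b ∈ T) (hab : a < b)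
    (hL : ∀ t ∈ interval T a b, ContDiff ℝ 2 fun z : ℝ × ℝ => L t z.1 z.2)
    (hmin : IsLocalMinimizer T a b 0 0 L (fun _ => 0)) :
    ∃ C, ∀ t ∈ T, a ≤ t → t < b → coeffQ L t 0 = C + deltaIntegral T (Px0 L) a t := by
  set H : ℝ → ℝ := fun t => deltaIntegral T (Px0 L) a t with hH
  set g : ℝ → ℝ := fun t => coeffQ L t 0 - H t with hg
  set c : ℝ := deltaIntegral T g a b / (b - a) with hcdef
  set η : ℝ → ℝ := fun t => deltaIntegral T (fun τ => g τ - c) a t with hη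
  have hηa : η a = 0 := deltaIntegral_self _ _ _
  have hηb : η b = 0 := by
    have h := hT.deltaIntegral_eq_of_step hc ha hb (f := fun τ => g τ - c)
      (G := fun t => deltaIntegral T g a t - c * (t - a)) (by simp [deltaIntegral_self])
      (fun t ht _ htb => by
        rw [hT.deltaIntegral_sigma hc g a (mem_kappa_of_lt ht hb htb), smul_eq_mul, mu]
        ring) b hb hab.le le_rfl
    have hne : b - a ≠ 0 := (sub_pos.2 hab).ne'
    change deltaIntegral T (fun τ => g τ - c) a b = 0
    rw [h, hcdef, div_mul_cancel₀ _ hne, sub_self]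
  have hησ : ∀ t ∈ T, t < b → η (sigma T t) = η t + mu T t * (g t - c) := fun t ht htb =>
    hT.deltaIntegral_sigma hc _ a (mem_kappa_of_lt ht hb htb)
  have hHσ : ∀ t ∈ T, t < b → H (sigma T t) = H t + mu T t * Px0 L t := fun t ht htb =>
    hT.deltaIntegral_sigma hc _ a (mem_kappa_of_lt ht hb htb)
  have hηΔ : ∀ t ∈ T, t < b → deltaDeriv T η t = g t - c := fun t ht htb =>
    hT.deltaDeriv_eq ht (hT.mu_pos ht hb htb).ne' (by rw [hησ t ht htb, smul_eq_mul]; ring)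
  have hvar := hT.firstVariation_eq_zero hc ha hb hab hL hmin hηa hηb
  -- Summation by parts: the integrand is `(g - c)² + (Hη)^Δ + c η^Δ`, and the last two terms vanish
  -- at both ends.
  have hparts := hT.deltaIntegral_eq_of_step hc ha hb
    (f := fun t => Px0 L t * η (sigma T t) + coeffQ L t 0 * deltaDeriv T η t)
    (G := fun t => deltaIntegral T (fun τ => (g τ - c) ^ 2) a t + H t * η t + c * η t)
    (by simp [deltaIntegral_self, hηa])
    (fun t ht _ htb => by
      rw [hT.deltaIntegral_sigma hc _ a (mem_kappa_of_lt ht hb htb), smul_eq_mul, hηΔ t ht htb,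
        hησ t ht htb, hHσ t ht htb, show coeffQ L t 0 = g t + H t by simp [hg]]
      ring) b hb hab.le le_rfl
  rw [hvar, hηb] at hparts
  refine ⟨c, fun t ht hat htb => ?_⟩
  have hsq := (hT.eq_zero_of_deltaIntegral_eq_zero hc ha hb (f := fun τ => (g τ - c) ^ 2)
    (fun _ => sq_nonneg _) b hb hab.le le_rfl).2 (by linarith) t ht hat htb
  have h0 : g t - c = 0 := pow_eq_zero_iff two_ne_zero |>.1 hsq
  simp only [hg] at h0
  linarith

end EulerLagrange
end TimeScale

/-! ### The main theorem -/

open TimeScale in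
theorem mainTheorem3 (T : Set ℝ) (hT : IsTimeScale T) (hiso : IsIsolated T)
    (a b : ℝ) (ha : a ∈ T) (hb : b ∈ T) (hab : a < b)
    -- at least three points of `T` lie in `[a, ∞)`
    (h3 : ∃ c ∈ T, ∃ d ∈ T, a < c ∧ c < d)
    (L : ℝ → ℝ → ℝ → ℝ) (hL : RegularLagrangian T a b L)
    (hmin : IsLocalMinimizer T a b 0 0 L (fun _ => 0))
    (hLeg : StrengthenedLegendre T a b L (fun _ => 0)) :
    ∃ (C R₀ : ℝ) (p : ℝ → ℝ) (q : ℝ → ℝ → ℝ) (w : ℝ → ℝ → ℝ → ℝ),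
      -- regularity of `P`
      UniformlyContDiff 2 (interval T a b) (coeffP L) ∧
      RdAlongPaths T a b (fun t x _ => coeffP L t x) ∧
      RdAlongPaths T a b (fun t x _ => deriv (coeffP L t) x) ∧
      RdContinuous (interval T a b) (Pxx0 L) ∧
      -- regularity and positivity of `p`
      C1rd (interval T a b) p ∧
      (∀ t ∈ kappa (kappa (interval T a b)), 0 < p t) ∧
      -- regularity of `q`
      UniformlyContDiff 1 (interval T a b) q ∧
      (UniformlyContDiff 2 (interval T a b) (coeffQ L) →
        UniformlyContDiff 2 (interval T a b) q) ∧
      RdAlongPaths T a b (fun t x _ => q t x) ∧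
      RdAlongPaths T a b (fun t x _ => deriv (q t) x) ∧
      -- regularity of `w`
      UniformlyContDiff 0 (interval T a b) (fun t (z : ℝ × ℝ) => w t z.1 z.2) ∧
      RdAlongPaths T a b w ∧
      (UniformlyContDiff 2 (interval T a b) (fun t (z : ℝ × ℝ) => Lvv L t z.1 z.2) →
        UniformlyContDiff 2 (interval T a b) (fun t (z : ℝ × ℝ) => w t z.1 z.2) ∧
        RdAlongPaths T a b (Lx w) ∧ RdAlongPaths T a b (Lv w) ∧ RdAlongPaths T a b (Lvv w)) ∧
      -- the Legendre expression equals `p`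
      (∀ t ∈ kappa (kappa (interval T a b)),
        coeffR L t 0 + mu T t * (2 * Qx0 L t + mu T t * Pxx0 L t
          + (mu T (sigma T t))⁻¹ * coeffR L (sigma T t) 0) = p t) ∧
      -- `r` is regressive and `R(·,0,0)` solves `R^Δ = r R + s`, `R(a,0,0) = R₀`
      RdContinuous (kappa (kappa (interval T a b))) (rFun T) ∧
      (∀ t ∈ kappa (kappa (interval T a b)), 1 + mu T t * rFun T t ≠ 0) ∧
      (∀ t ∈ kappa (kappa (interval T a b)),
        HasDeltaDerivAt T (fun u => coeffR L u 0)
          (rFun T t * coeffR L t 0 + sFun T L p t) t) ∧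
      coeffR L a 0 = R₀ ∧
      -- the explicit form of `R(·,0,0)`
      (∀ t ∈ kappa (interval T a b),
        coeffR L t 0 = timeExp T (rFun T) t a * R₀ +
          deltaIntegral T (fun τ => timeExp T (rFun T) t (sigma T τ) * sFun T L p τ) a t) ∧
      -- the explicit form of the Lagrangian
      (∀ t ∈ kappa (interval T a b), ∀ x v : ℝ,
        L t x v = coeffP L t x
          + (C + deltaIntegral T (Px0 L) a t + q t x - q t 0) * v
          + (timeExp T (rFun T) t a * R₀
              + deltaIntegral T (fun τ => timeExp T (rFun T) t (sigma T τ) * sFun T L p τ) a t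
              + w t x v - w t 0 0) * (v ^ 2 / 2)) := by
  have hc := hT.1
  have hfin := hiso.interval_finite hc a b
  have hrd := hiso.rdAlongPaths a b
  have hLt : ∀ t ∈ interval T a b, ContDiff ℝ 2 fun z : ℝ × ℝ => L t z.1 z.2 := hL.contDiff.1
  have hLv : ∀ t ∈ interval T a b, ContDiff ℝ (1 : ℕ) fun z : ℝ × ℝ => Lv L t z.1 z.2 :=
    fun t ht => contDiff_deriv_snd (n := 1) (hLt t ht)
  have hLvv : ∀ t ∈ interval T a b, ContDiff ℝ (0 : ℕ) fun z : ℝ × ℝ => Lvv L t z.1 z.2 :=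
    fun t ht => contDiff_deriv_snd (n := 0) (hLv t ht)
  obtain ⟨C, hC⟩ := hiso.eulerLagrange hc ha hb hab hLt hmin
  have hmem : ∀ t ∈ kappa (kappa (interval T a b)), t ∈ T ∧ a ≤ t ∧ t < b := fun t ht =>
    (hiso.mem_kappa_interval_iff hc ha hb hab).1 ht.1
  have hμ : ∀ t ∈ kappa (kappa (interval T a b)), 0 < mu T t := fun t ht =>
    hiso.mu_pos (hmem t ht).1 hb (hmem t ht).2.2
  have hσ : ∀ t ∈ kappa (kappa (interval T a b)), sigma T t ∈ T := fun t ht =>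
    sigma_mem hc hb (hmem t ht).2.2
  have hμσ : ∀ t ∈ kappa (kappa (interval T a b)), 0 < mu T (sigma T t) := fun t ht =>
    have ⟨_, hd, hlt⟩ := hiso.exists_gt_sigma hc ha hb hab h3 ht
    hiso.mu_pos (hσ t ht) hd hlt
  set p : ℝ → ℝ := fun t => coeffR L t 0 + mu T t * (2 * Qx0 L t + mu T t * Pxx0 L t
    + (mu T (sigma T t))⁻¹ * coeffR L (sigma T t) 0) with hp
  have hreg : ∀ t ∈ kappa (kappa (interval T a b)), 1 + mu T t * rFun T t ≠ 0 := by
    intro t ht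
    have h1 := (hμ t ht).ne'
    have h2 := (hμσ t ht).ne'
    -- The factor is negative, so `e_r(·,a)` changes sign at every step and the complex logarithm is
    -- indispensable.
    have : 1 + mu T t * rFun T t = -(mu T (sigma T t) / mu T t) := by
      rw [rFun]
      field_simp
      ring
    rw [this]
    exact neg_ne_zero.2 (div_ne_zero h2 h1)
  have hR : ∀ t ∈ kappa (kappa (interval T a b)), coeffR L (sigma T t) 0 - coeffR L t 0 =
      mu T t * (rFun T t * coeffR L t 0 + sFun T L p t) := by
    intro t ht
    have h1 := (hμ t ht).ne'
    have h2 := (hμσ t ht).ne'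
    simp only [rFun, sFun, hp]
    field_simp
    ring
  have hRsol : ∀ t ∈ kappa (interval T a b), coeffR L t 0 =
      timeExp T (rFun T) t a * coeffR L a 0 +
        deltaIntegral T (fun τ => timeExp T (rFun T) t (sigma T τ) * sFun T L p τ) a t := by
    intro t ht
    have htT := ((hiso.mem_kappa_interval_iff hc ha hb hab).1 ht)
    -- The equation on `κ²` determines `R` on all of `κ`: reaching `t` uses only steps from earlier
    -- points.
    have hk : ∀ τ ∈ T, a ≤ τ → τ < t → τ ∈ kappa (kappa (interval T a b)) :=
      fun _ h1 h2 h3 => hiso.mem_kappa_kappa_interval hc ha hb hab h1 h2 h3 ht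
    exact hiso.eq_timeExp_mul_add hc ha htT.1 (X := fun u => coeffR L u 0)
      (fun τ h1 h2 h3 => hreg τ (hk τ h1 h2 h3))
      (fun τ h1 h2 h3 => eq_add_of_sub_eq' (hR τ (hk τ h1 h2 h3))) t htT.1 htT.2.1 le_rfl
  have hq1 : UniformlyContDiff 1 (interval T a b) (coeffQ L) :=
    (uniformlyContDiff_iff_of_finite hfin).2 fun t ht =>
      (hLv t ht).comp (contDiff_id.prodMk contDiff_const)
  refine ⟨C, coeffR L a 0, p, coeffQ L, remainderCoeff L, ?_, hrd _, hrd _,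
    (hiso.isIsolated_interval a b).rdContinuous _, (hiso.isIsolated_interval a b).c1rd _, ?_, hq1,
    id, hrd _, hrd _, ?_, hrd _, fun h => ⟨?_, hrd _, hrd _, hrd _⟩, fun _ _ => rfl,
    ((hiso.isIsolated_interval a b).mono ((kappa_subset _).trans (kappa_subset _))).rdContinuous _,
    hreg, ?_, rfl, hRsol, ?_⟩
  · exact (uniformlyContDiff_iff_of_finite hfin).2 fun t ht =>
      (hLt t ht).comp (contDiff_id.prodMk contDiff_const)
  · intro t ht
    -- Even for the zero function, `deltaDeriv` is an arbitrary choice where `μ = 0`; positivity is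
    -- needed at both `t` and `σ(t)`.
    have h0 : ∀ u ∈ T, 0 < mu T u → deltaDeriv T (fun _ => (0 : ℝ)) u = 0 := fun u hu hμu =>
      hiso.deltaDeriv_eq hu hμu.ne' (by simp)
    have h := hLeg t ht
    simp only [h0 t (hmem t ht).1 (hμ t ht), h0 _ (hσ t ht) (hμσ t ht)] at h
    change 0 < coeffR L t 0 + mu T t * (Qx0 L t + Qx0 L t + mu T t * Pxx0 L t
      + (mu T (sigma T t))⁻¹ * coeffR L (sigma T t) 0) at h
    rwa [← two_mul] at h
  · exact (uniformlyContDiff_iff_of_finite hfin).2 fun t ht => contDiff_remainderCoeff (hLvv t ht)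
  · exact (uniformlyContDiff_iff_of_finite hfin).2 fun t ht => contDiff_remainderCoeff (h.1 t ht)
  · exact fun t ht => (hiso.hasDeltaDerivAt_iff (hmem t ht).1 _ _).2 (hR t ht)
  · intro t ht x v
    have htT := ((hiso.mem_kappa_interval_iff hc ha hb hab).1 ht)
    have hR0 : remainderCoeff L t 0 0 = coeffR L t 0 := remainderCoeff_zero L t 0
    rw [← hRsol t ht, ← hC t htT.1 htT.2.1 htT.2.2, hR0, add_sub_cancel_left, add_sub_cancel_left,
      eq_add_remainderCoeff (hLt t ht.1) x v]
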